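/- Let $R$ be a commutative ring with identity. An ideal $I$ of $R$ is called semi-regular if it contains a finitely generated ideal $J$ with $(0:_R J)=\{r\in R : rJ=0\}=0$. The ring $R$ is called strong Prüfer if every finitely generated semi-regular ideal $I$ is locally principal, i.e. $I_{\mathfrak m}$ is a principal ideal of $R_{\mathfrak m}$ for every maximal ideal $\mathfrak m$. An $R$-module $M$ is called semi-regular flat (respectively, semi-regular coflat) if $\mathrm{Tor}_1^R(R/I,M)=0$ (respectively, $\mathrm{Ext}^1_R(R/I,M)=0$) for every finitely generated semi-regular ideal $I$ of $R$. An $R$-module is called $h$-divisible if it is a homomorphic image of an injective $R$-module. Theorem. For a commutative ring $R$ the following statements are equivalent: 1. $R$ is a strong Prüfer ring; 2. every submodule of a semi-regular flat $R$-module is semi-regular flat; 3. every submodule of a flat $R$-module is semi-regular flat; 4. every ideal of $R$ is semi-regular flat; 5. every finitely generated ideal of $R$ is semi-regular flat; 6. every finitely generated semi-regular ideal of $R$ is flat; 7. every finitely generated semi-regular ideal of $R$ is projective; 8. every quotient of a semi-regular coflat $R$-module is semi-regular coflat; 9. every $h$-divisible $R$-module is semi-regular coflat. -/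

import Mathlib

universe u

namespace StrongPrufer

open CategoryTheory

/-- An ideal `I` is dense if `(0 :_R I) = 0`. -/
def IsDense {R : Type u} [CommRing R] (I : Ideal R) : Prop :=
  Submodule.annihilator I = ⊥

/-- An ideal is semi-regular if it contains a finitely generated dense sub-ideal. -/
def IsSemiRegular {R : Type u} [CommRing R] (I : Ideal R) : Prop :=
  ∃ J : Ideal R, J ≤ I ∧ J.FG ∧ IsDense J

/-- An ideal `I` is locally principal if `I_m` is a principal ideal of `R_m` for every maximal
ideal `m`. -/
def IsLocallyPrincipal {R : Type u} [CommRing R] (I : Ideal R) : Prop :=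
  ∀ (m : Ideal R) [m.IsMaximal],
    (I.map (algebraMap R (Localization.AtPrime m))).IsPrincipal

/-- A ring is strong Prüfer if every finitely generated semi-regular ideal is locally
principal. -/
def IsStrongPrufer (R : Type u) [CommRing R] : Prop :=
  ∀ I : Ideal R, I.FG → IsSemiRegular I → IsLocallyPrincipal I

/-- `M` is semi-regular flat if `Tor₁(R/I, M) = 0` for every finitely generated semi-regular
ideal `I`. -/
def IsSemiRegularFlat (R : Type u) [CommRing R] (M : Type u) [AddCommGroup M] [Module R M] :
    Prop :=
  ∀ I : Ideal R, I.FG → IsSemiRegular I →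
    Limits.IsZero (((Tor (ModuleCat.{u} R) 1).obj (ModuleCat.of R (R ⧸ I))).obj (ModuleCat.of R M))

/-- `M` is semi-regular coflat if `Ext¹(R/I, M) = 0` for every finitely generated semi-regular
ideal `I`. -/
def IsSemiRegularCoflat (R : Type u) [CommRing R] (M : Type u) [AddCommGroup M] [Module R M] :
    Prop :=
  ∀ I : Ideal R, I.FG → IsSemiRegular I →
    Subsingleton (Abelian.Ext (ModuleCat.of R (R ⧸ I)) (ModuleCat.of R M) 1)

/-- `M` is `h`-divisible if it is an epimorphic image of an injective module. -/
def IsHDivisible (R : Type u) [CommRing R] (M : Type u) [AddCommGroup M] [Module R M] : Prop :=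
  ∃ (E : Type u) (_ : AddCommGroup E) (_ : Module R E),
    Module.Injective R E ∧ ∃ f : E →ₗ[R] M, Function.Surjective f

end StrongPrufer

namespace StrongPrufer

open CategoryTheory TensorProduct LinearMap

/-! ### Locally principal, flat and projective ideals -/

section IdealProjectivity

variable {R : Type u} [CommRing R]

/-! The hub is projectivity of finitely generated semi-regular ideals `I`. If `I` is locally
principal, then at each `m` some `s ∉ m` and `x ∈ I` satisfy `s I ⊆ x R`; density permits division
by `x` after a further factor `s`, so `s²` on `I` factors through `R`, and such `s²` generate the
unit ideal. Conversely, a flat `I` is locally free, and a free ideal is principal. Vanishing of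
`Tor₁(R/I, M)` means that `I ⊗ M → R ⊗ M` is injective; for `M = J` an ideal this is symmetric in
`I` and `J`, which ties semi-regular flat ideals to flat semi-regular ones. Vanishing of `Ext¹(R/I,
M)` means that maps `I → M` extend to `R`; over an injective `E`, extending `I → E/K` to `R` lifts
it to `E`, which yields projectivity. -/

lemma IsSemiRegular.isDense {I : Ideal R} (h : IsSemiRegular I) : IsDense I := by
  obtain ⟨J, hJI, -, hJ⟩ := h
  exact eq_bot_iff.2 ((Submodule.annihilator_mono hJI).trans hJ.le)

lemma IsDense.eq_zero {I : Ideal R} (h : IsDense I) {r : R} (hr : ∀ a ∈ I, r * a = 0) : r = 0 := by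
  have : r ∈ Submodule.annihilator I := Submodule.mem_annihilator.2 hr
  rwa [h, Submodule.mem_bot] at this

/-- A free ideal of a commutative ring is principal. -/
lemma isPrincipal_of_free {A : Type*} [CommRing A] (I : Ideal A) [Module.Free A I] :
    I.IsPrincipal := by
  nontriviality A
  let b := Module.Free.chooseBasis A I
  have hsub : Subsingleton (Module.Free.ChooseBasisIndex A I) := by
    refine ⟨fun i j => by_contra fun hij => ?_⟩
    -- Two elements of an ideal always satisfy this relation, so distinct basis vectors would force
    -- `b j = 0`.
    have hrel : (b j : A) • b i = (b i : A) • b j := Subtype.ext (mul_comm _ _)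
    have hrepr := DFunLike.congr_fun (congrArg b.repr hrel) i
    refine b.ne_zero j (Subtype.ext ?_)
    simpa [Finsupp.single_eq_of_ne hij] using hrepr
  have : (⊤ : Submodule A I).IsPrincipal := by
    rw [← b.span_eq]
    rcases isEmpty_or_nonempty (Module.Free.ChooseBasisIndex A I) with h | ⟨⟨i⟩⟩
    · rw [Set.range_eq_empty, Submodule.span_empty]
      exact bot_isPrincipal
    · refine ⟨b i, ?_⟩
      congr 1
      ext z
      exact ⟨fun ⟨j, hj⟩ => by rw [← hj, Subsingleton.elim j i]; rfl, fun h => ⟨i, h.symm⟩⟩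
  have := this.map I.subtype
  rwa [Submodule.map_top, Submodule.range_subtype] at this

/-- A finitely generated flat ideal is locally principal. -/
lemma isLocallyPrincipal_of_flat {I : Ideal R} (hI : I.FG) [Module.Flat R I] :
    IsLocallyPrincipal I := by
  intro m _
  let Rm := Localization.AtPrime m
  have : Module.Flat Rm (I.map (algebraMap R Rm)) :=
    Module.Flat.of_isLocalizedModule Rm m.primeCompl (Algebra.idealMap Rm I)
  have : Module.Finite Rm (I.map (algebraMap R Rm)) :=
    Module.Finite.iff_fg.2 (hI.map _)
  have : Module.Free Rm (I.map (algebraMap R Rm)) := Module.free_of_flat_of_isLocalRing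
  exact isPrincipal_of_free _

/-- A finitely generated locally principal ideal is, up to a denominator avoiding a given maximal
ideal, contained in the principal ideal of one of its elements. -/
lemma IsLocallyPrincipal.exists_mul_mem_span {I : Ideal R} (h : IsLocallyPrincipal I) (hI : I.FG)
    (m : Ideal R) [m.IsMaximal] :
    ∃ x ∈ I, ∃ s ∉ m, ∀ a ∈ I, s * a ∈ Ideal.span {x} := by
  classical
  let Rm := Localization.AtPrime m
  obtain ⟨y, hy⟩ := (h m).principal
  have hyI : y ∈ I.map (algebraMap R Rm) := hy ▸ Submodule.mem_span_singleton_self y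
  obtain ⟨⟨x, t⟩, hx⟩ := (IsLocalization.mem_map_algebraMap_iff m.primeCompl Rm).1 hyI
  have key (a : R) (ha : a ∈ I) : ∃ s ∉ m, s * a ∈ Ideal.span {(x : R)} := by
    have ha' : algebraMap R Rm a ∈ (Ideal.span {(x : R)}).map (algebraMap R Rm) := by
      have h1 : algebraMap R Rm a ∈ Submodule.span Rm {y} := hy ▸ Ideal.mem_map_of_mem _ ha
      obtain ⟨c, hc⟩ := Submodule.mem_span_singleton.1 h1
      have hy' : y ∈ (Ideal.span {(x : R)}).map (algebraMap R Rm) :=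
        (IsLocalization.mem_map_algebraMap_iff m.primeCompl Rm).2
          ⟨⟨⟨x, Ideal.mem_span_singleton_self _⟩, t⟩, hx⟩
      rw [← hc]
      exact Ideal.mul_mem_left _ _ hy'
    obtain ⟨s, hs, hsa⟩ :=
      (IsLocalization.algebraMap_mem_map_algebraMap_iff m.primeCompl Rm _ _).1 ha'
    exact ⟨s, hs, hsa⟩
  obtain ⟨S, rfl⟩ := hI
  choose! s hsm hs using key
  refine ⟨x, x.2, ∏ a ∈ S, s a, ?_, fun a ha => ?_⟩
  · exact (Ideal.IsPrime.prod_mem_iff (p := m)).not.2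
      (fun ⟨a, ha, h⟩ => hsm a (Ideal.subset_span ha) h)
  · have : Ideal.span (S : Set R) ≤
        Submodule.comap (LinearMap.mulLeft R (∏ a ∈ S, s a)) (Ideal.span {(x : R)}) := by
      refine Ideal.span_le.2 fun b hb => ?_
      change (∏ a ∈ S, s a) * b ∈ Ideal.span {(x : R)}
      rw [← Finset.prod_erase_mul S s hb, mul_assoc]
      exact Ideal.mul_mem_left _ _ (hs b (Ideal.subset_span hb))
    exact this ha

/-- If `I` is dense and `s I ⊆ x R` then a multiple of `s` on `I` is `x` times a functional. -/
lemma IsDense.exists_functional {I : Ideal R} (h : IsDense I) {x s : R}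
    (hs : ∀ a ∈ I, s * a ∈ Ideal.span {x}) :
    ∃ φ : I →ₗ[R] R, ∀ a : I, φ a * x = s * s * a := by
  have hr (a : I) : ∃ r, r * x = s * a := Ideal.mem_span_singleton'.1 (hs a a.2)
  -- `x` may be a zero divisor, so `r` is not determined by `r * x`; but `s * (r - r')` kills `I`,
  -- so `s * r` is. Hence the square of `s`.
  have uniq {r r' : R} (e : r * x = r' * x) : s * r = s * r' := by
    rw [← sub_eq_zero, ← mul_sub]
    refine h.eq_zero fun a ha => ?_
    obtain ⟨c, hc⟩ := Ideal.mem_span_singleton'.1 (hs a ha)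
    linear_combination (-(r - r')) * hc + c * e
  choose r hr using hr
  refine ⟨{ toFun := fun a => s * r a, map_add' := fun a b => ?_, map_smul' := fun c a => ?_ },
    fun a => ?_⟩
  · rw [← mul_add]
    apply uniq
    rw [add_mul, hr, hr, hr, Submodule.coe_add, mul_add]
  · rw [RingHom.id_apply, smul_eq_mul, mul_left_comm]
    apply uniq
    rw [mul_assoc, hr, hr, Submodule.coe_smul, smul_eq_mul, mul_left_comm]
  · change s * r a * x = _
    rw [mul_assoc, hr, mul_assoc]

/-- A module is projective if, for each maximal ideal, multiplication by some element outside that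
ideal factors through the ring. -/
lemma projective_of_locally_factors {M : Type*} [AddCommGroup M] [Module R M]
    (h : ∀ m : Ideal R, m.IsMaximal → ∃ s ∉ m, ∃ (φ : M →ₗ[R] R) (x : M), ∀ a, φ a • x = s • a) :
    Module.Projective R M := by
  refine Module.Projective.of_lifting_property'' fun f hf => ?_
  -- The scalars `c` for which `f` has a section up to `c`; it splits once `1 ∈ T`.
  let T : Ideal R :=
    { carrier := {c | ∃ g : M →ₗ[R] (M →₀ R), f.comp g = c • LinearMap.id}
      add_mem' := by
        rintro a b ⟨g, hg⟩ ⟨k, hk⟩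
        exact ⟨g + k, by rw [LinearMap.comp_add, hg, hk, add_smul]⟩
      zero_mem' := ⟨0, by simp⟩
      smul_mem' := by
        rintro c a ⟨g, hg⟩
        exact ⟨c • g, by rw [LinearMap.comp_smul, hg, smul_smul, smul_eq_mul]⟩ }
  have hT : T = ⊤ := by
    by_contra hne
    obtain ⟨m, hm, hTm⟩ := Ideal.exists_le_maximal T hne
    obtain ⟨s, hsm, φ, x, hφ⟩ := h m hm
    obtain ⟨z, hz⟩ := hf x
    refine hsm (hTm ⟨φ.smulRight z, ?_⟩)
    ext a
    simp [hz, hφ]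
  obtain ⟨g, hg⟩ : (1 : R) ∈ T := hT ▸ Submodule.mem_top
  exact ⟨g, by rw [hg, one_smul]⟩

lemma IsLocallyPrincipal.projective {I : Ideal R} (h : IsLocallyPrincipal I) (hI : I.FG)
    (hd : IsDense I) : Module.Projective R I := by
  refine projective_of_locally_factors fun m hm => ?_
  obtain ⟨x, hx, s, hsm, hs⟩ := h.exists_mul_mem_span hI m
  obtain ⟨φ, hφ⟩ := hd.exists_functional hs
  exact ⟨s * s, fun hss => (hm.isPrime.mem_or_mem hss).elim hsm hsm, φ, ⟨x, hx⟩,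
    fun a => Subtype.ext (hφ a)⟩

end IdealProjectivity

/-! ### Tor and semi-regular flatness -/

section Tor

variable {R : Type u} [CommRing R]

/-- For a short exact sequence `K → P → M` with `P` flat and a short exact sequence `I → R → R/I`, the two
kernels `Tor₁(R/I, M)` computed from either sequence vanish simultaneously. -/
lemma lTensor_quotient_injective_iff (I : Ideal R) {K P M : Type*} [AddCommGroup K] [Module R K]
    [AddCommGroup P] [Module R P] [AddCommGroup M] [Module R M] [Module.Flat R P]
    {f : K →ₗ[R] P} {g : P →ₗ[R] M} (hf : Function.Injective f) (hfg : Function.Exact f g)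
    (hg : Function.Surjective g) :
    Function.Injective (f.lTensor (R ⧸ I)) ↔ Function.Injective (I.subtype.rTensor M) := by
  have hI : Function.Exact I.subtype I.mkQ := LinearMap.exact_subtype_mkQ I
  have hq : Function.Surjective I.mkQ := I.mkQ_surjective
  have exK := rTensor_exact K hI hq
  have exP := rTensor_exact P hI hq
  have exI := lTensor_exact I hfg hg
  have exR := lTensor_exact R hfg hg
  have injP : Function.Injective (I.subtype.rTensor P) :=
    Module.Flat.rTensor_preserves_injective_linearMap _ I.injective_subtype
  have injR : Function.Injective (f.lTensor R) :=
    Module.Flat.lTensor_preserves_injective_linearMap _ hf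
  have c1 (z) : f.lTensor R (I.subtype.rTensor K z) = I.subtype.rTensor P (f.lTensor I z) := by
    rw [← LinearMap.comp_apply, ← LinearMap.comp_apply, lTensor_comp_rTensor, rTensor_comp_lTensor]
  have c2 (z) : g.lTensor R (I.subtype.rTensor P z) = I.subtype.rTensor M (g.lTensor I z) := by
    rw [← LinearMap.comp_apply, ← LinearMap.comp_apply, lTensor_comp_rTensor, rTensor_comp_lTensor]
  have c3 (z) : f.lTensor (R ⧸ I) (I.mkQ.rTensor K z) = I.mkQ.rTensor P (f.lTensor R z) := by
    rw [← LinearMap.comp_apply, ← LinearMap.comp_apply, lTensor_comp_rTensor, rTensor_comp_lTensor]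
  constructor
  · intro h
    refine (injective_iff_map_eq_zero _).2 fun w hw => ?_
    obtain ⟨p, rfl⟩ := lTensor_surjective I hg w
    rw [← c2] at hw
    obtain ⟨k, hk⟩ := (exR _).1 hw
    have h0 : I.mkQ.rTensor K k = 0 := h (by rw [c3, hk, map_zero]; exact (exP _).2 ⟨p, rfl⟩)
    obtain ⟨k', rfl⟩ := (exK _).1 h0
    rw [c1] at hk
    rw [← injP hk]
    exact (exI _).2 ⟨k', rfl⟩
  · intro h
    refine (injective_iff_map_eq_zero _).2 fun n hn => ?_
    obtain ⟨k, rfl⟩ := rTensor_surjective K hq n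
    rw [c3] at hn
    obtain ⟨p, hp⟩ := (exP _).1 hn
    have h0 : g.lTensor I p = 0 := h (by rw [← c2, hp, map_zero]; exact (exR _).2 ⟨k, rfl⟩)
    obtain ⟨k', rfl⟩ := (exI _).1 h0
    rw [← c1] at hp
    rw [← injR hp]
    exact (exK _).2 ⟨k', rfl⟩

/-- Tensoring an exact sequence `A → B → C` with `N` keeps it exact if and only if tensoring the
image of `B → C` with `N` keeps it inside `C`. -/
lemma lTensor_exact_iff_injective_subtype_range (N : Type*) [AddCommGroup N] [Module R N]
    {A B C : Type*} [AddCommGroup A] [Module R A] [AddCommGroup B] [Module R B]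
    [AddCommGroup C] [Module R C] {d : A →ₗ[R] B} {e : B →ₗ[R] C} (h : Function.Exact d e) :
    Function.Exact (d.lTensor N) (e.lTensor N) ↔
      Function.Injective (e.range.subtype.lTensor N) := by
  have hr : Function.Exact d e.rangeRestrict := fun b => by
    rw [← h b, ← e.range.subtype.map_eq_zero_iff e.range.injective_subtype]
    rfl
  have ex := lTensor_exact N hr e.surjective_rangeRestrict
  have c (z) : e.range.subtype.lTensor N (e.rangeRestrict.lTensor N z) = e.lTensor N z := by
    rw [← lTensor_comp_apply]
    rfl
  constructor
  · intro H
    refine (injective_iff_map_eq_zero _).2 fun n hn => ?_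
    obtain ⟨z, rfl⟩ := lTensor_surjective N e.surjective_rangeRestrict n
    rw [c] at hn
    exact (ex z).2 ((H z).1 hn)
  · intro H z
    rw [← ex z, ← c]
    exact map_eq_zero_iff _ H

/-- `Tor₁(R/I, M)` vanishes if and only if `I ⊗ M → R ⊗ M` is injective. -/
lemma isZero_tor_one_iff (I : Ideal R) (M : Type u) [AddCommGroup M] [Module R M] :
    Limits.IsZero
      (((Tor (ModuleCat.{u} R) 1).obj (ModuleCat.of R (R ⧸ I))).obj (ModuleCat.of R M)) ↔
      Function.Injective (I.subtype.rTensor M) := by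
  let P := projectiveResolution (ModuleCat.of R M)
  let F := (MonoidalCategory.tensoringLeft (ModuleCat.{u} R)).obj (ModuleCat.of R (R ⧸ I))
  have h21 : Function.Exact (P.complex.d 2 1).hom (P.complex.d 1 0).hom :=
    (ShortComplex.ShortExact.moduleCat_exact_iff_function_exact _).1 (P.exact_succ 0)
  have h10 : Function.Exact (P.complex.d 1 0).hom (P.π.f 0).hom :=
    (ShortComplex.ShortExact.moduleCat_exact_iff_function_exact _).1
      (ShortComplex.exact_of_g_is_cokernel
        (ShortComplex.mk _ _ P.complex_d_comp_π_f_zero) P.isColimitCokernelCofork)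
  have hπ : Function.Surjective (P.π.f 0).hom := (ModuleCat.epi_iff_surjective _).1 inferInstance
  have : Module.Projective R (P.complex.X 0) :=
    (IsProjective.iff_projective _).2 (P.projective 0)
  have hrange : Function.Exact (P.complex.d 1 0).hom.range.subtype (P.π.f 0).hom := fun x => by
    rw [h10 x]; simp
  refine Iff.trans ?_ (lTensor_quotient_injective_iff I (P := P.complex.X 0) (M := M)
    (Submodule.injective_subtype _) hrange hπ)
  rw [← lTensor_exact_iff_injective_subtype_range _ h21]
  refine (P.isoLeftDerivedObj F 1).isZero_iff.trans ?_
  refine (HomologicalComplex.exactAt_iff_isZero_homology _ _).symm.trans ?_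
  rw [HomologicalComplex.exactAt_iff' _ 2 1 0 (by simp) (by simp)]
  exact ShortComplex.ShortExact.moduleCat_exact_iff_function_exact _

lemma isSemiRegularFlat_iff (M : Type u) [AddCommGroup M] [Module R M] :
    IsSemiRegularFlat R M ↔
      ∀ I : Ideal R, I.FG → IsSemiRegular I → Function.Injective (I.subtype.rTensor M) := by
  simp only [IsSemiRegularFlat, isZero_tor_one_iff]

lemma isSemiRegularFlat_of_flat (M : Type u) [AddCommGroup M] [Module R M] [Module.Flat R M] :
    IsSemiRegularFlat R M :=
  (isSemiRegularFlat_iff M).2 fun I _ _ =>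
    Module.Flat.rTensor_preserves_injective_linearMap _ I.injective_subtype

/-- The injection `I ⊗ N → I ⊗ M → R ⊗ M` also factors through `I ⊗ N → R ⊗ N`. -/
lemma IsSemiRegularFlat.submodule {M : Type u} [AddCommGroup M] [Module R M]
    (hM : IsSemiRegularFlat R M)
    (h : ∀ I : Ideal R, I.FG → IsSemiRegular I → Module.Flat R I) (N : Submodule R M) :
    IsSemiRegularFlat R N := by
  rw [isSemiRegularFlat_iff] at hM ⊢
  intro I hI hs
  have := h I hI hs
  have h1 : Function.Injective (I.subtype.rTensor M ∘ₗ N.subtype.lTensor I) :=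
    (hM I hI hs).comp
      (Module.Flat.lTensor_preserves_injective_linearMap _ N.injective_subtype)
  rw [rTensor_comp_lTensor, ← lTensor_comp_rTensor] at h1
  exact Function.Injective.of_comp h1

/-- Both routes `I ⊗ J → R ⊗ R` agree, so injectivity of `I ⊗ J → R ⊗ J` gives that of `I ⊗ J → I ⊗
R`; finitely generated `J` suffice to test flatness. -/
lemma flat_of_forall_isSemiRegularFlat (h : ∀ J : Ideal R, J.FG → IsSemiRegularFlat R J)
    (I : Ideal R) (hI : I.FG) (hs : IsSemiRegular I) : Module.Flat R I := by
  refine Module.Flat.iff_lTensor_injective.2 fun J hJ => ?_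
  have hJR : Function.Injective (J.subtype.lTensor R) :=
    Module.Flat.lTensor_preserves_injective_linearMap _ J.injective_subtype
  have h1 : Function.Injective (J.subtype.lTensor R ∘ₗ I.subtype.rTensor J) :=
    hJR.comp ((isSemiRegularFlat_iff J).1 (h J hJ) I hI hs)
  rw [lTensor_comp_rTensor, ← rTensor_comp_lTensor] at h1
  exact Function.Injective.of_comp h1

end Tor

/-! ### Ext and semi-regular coflatness -/

section Ext

variable {R : Type u} [CommRing R]

/-- `Ext¹(R/I, M)` vanishes if and only if every linear map `I → M` extends to `R`. -/
lemma subsingleton_ext_one_iff (I : Ideal R) (M : Type u) [AddCommGroup M] [Module R M] :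
    Subsingleton (Abelian.Ext (ModuleCat.of R (R ⧸ I)) (ModuleCat.of R M) 1) ↔
      ∀ f : I →ₗ[R] M, ∃ g : R →ₗ[R] M, g ∘ₗ I.subtype = f := by
  let S : ShortComplex (ModuleCat.{u} R) :=
    ShortComplex.mk (ModuleCat.ofHom I.subtype) (ModuleCat.ofHom I.mkQ) (by
      ext x
      exact (Submodule.Quotient.mk_eq_zero I).2 x.2)
  have hS : S.ShortExact :=
    { exact := (ShortComplex.ShortExact.moduleCat_exact_iff_function_exact _).2 (LinearMap.exact_subtype_mkQ I)
      mono_f := (ModuleCat.mono_iff_injective _).2 I.injective_subtype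
      epi_g := (ModuleCat.epi_iff_surjective _).2 I.mkQ_surjective }
  have hproj : Projective S.X₂ := (IsProjective.iff_projective (R := R) R).1 inferInstance
  constructor
  · intro hsub f
    obtain ⟨x, hx⟩ := Abelian.Ext.contravariant_sequence_exact₁ hS (ModuleCat.of R M)
      (Abelian.Ext.mk₀ (ModuleCat.ofHom f)) (n₁ := 1) rfl 
      (Subsingleton.elim (α := Abelian.Ext (ModuleCat.of R (R ⧸ I)) (ModuleCat.of R M) 1) _ _)
    obtain ⟨g, rfl⟩ := (Abelian.Ext.mk₀_bijective _ _).2 x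
    rw [Abelian.Ext.mk₀_comp_mk₀] at hx
    have := (Abelian.Ext.mk₀_bijective _ _).1 hx
    exact ⟨g.hom, congrArg ModuleCat.Hom.hom this⟩
  · intro h
    refine subsingleton_of_forall_eq 0 fun e => ?_
    obtain ⟨x, rfl⟩ := Abelian.Ext.contravariant_sequence_exact₃ hS (ModuleCat.of R M) e
      (Abelian.Ext.eq_zero_of_projective _) (n₀ := 0) rfl
    obtain ⟨f, rfl⟩ := (Abelian.Ext.mk₀_bijective _ _).2 x
    obtain ⟨g, hg⟩ := h f.hom
    have : f = S.f ≫ ModuleCat.ofHom g := ModuleCat.hom_ext hg.symm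
    rw [this, ← Abelian.Ext.mk₀_comp_mk₀, ShortComplex.ShortExact.extClass_comp_assoc]

lemma isSemiRegularCoflat_iff (M : Type u) [AddCommGroup M] [Module R M] :
    IsSemiRegularCoflat R M ↔ ∀ I : Ideal R, I.FG → IsSemiRegular I →
      ∀ f : I →ₗ[R] M, ∃ g : R →ₗ[R] M, g ∘ₗ I.subtype = f := by
  simp only [IsSemiRegularCoflat, subsingleton_ext_one_iff]

lemma isSemiRegularCoflat_of_injective (E : Type u) [AddCommGroup E] [Module R E]
    [Module.Injective R E] : IsSemiRegularCoflat R E :=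
  (isSemiRegularCoflat_iff E).2 fun I _ _ f =>
    Module.Injective.extension_property R E I R I.subtype I.injective_subtype f

/-- A map `I → N` lifts to `M` by projectivity, extends to `R` there, and is pushed back to `N`. -/
lemma IsSemiRegularCoflat.of_surjective {M N : Type u} [AddCommGroup M] [Module R M]
    [AddCommGroup N] [Module R N] (hM : IsSemiRegularCoflat R M)
    (h : ∀ I : Ideal R, I.FG → IsSemiRegular I → Module.Projective R I)
    (p : M →ₗ[R] N) (hp : Function.Surjective p) : IsSemiRegularCoflat R N := by
  rw [isSemiRegularCoflat_iff] at hM ⊢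
  intro I hI hs f
  have := h I hI hs
  obtain ⟨k, hk⟩ := Module.projective_lifting_property p f hp
  obtain ⟨g, hg⟩ := hM I hI hs k
  exact ⟨p ∘ₗ g, by rw [LinearMap.comp_assoc, hg, hk]⟩

lemma IsSemiRegularCoflat.of_linearEquiv {M N : Type u} [AddCommGroup M] [Module R M]
    [AddCommGroup N] [Module R N] (hM : IsSemiRegularCoflat R M) (e : M ≃ₗ[R] N) :
    IsSemiRegularCoflat R N := by
  rw [isSemiRegularCoflat_iff] at hM ⊢
  intro I hI hs f
  obtain ⟨g, hg⟩ := hM I hI hs (e.symm.toLinearMap ∘ₗ f)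
  refine ⟨e.toLinearMap ∘ₗ g, ?_⟩
  rw [LinearMap.comp_assoc, hg, ← LinearMap.comp_assoc]
  simp

/-- Every module embeds into an injective module of the same universe. -/
lemma exists_injective_embedding (M : Type u) [AddCommGroup M] [Module R M] :
    ∃ (E : Type u) (_ : AddCommGroup E) (_ : Module R E), Module.Injective R E ∧
      ∃ i : M →ₗ[R] E, Function.Injective i := by
  let E := Injective.under (ModuleCat.of R M)
  have hE : Injective (ModuleCat.of R E) := inferInstanceAs (Injective E)
  exact ⟨E, inferInstance, inferInstance, Module.injective_module_of_injective_object R E,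
    (Injective.ι (ModuleCat.of R M)).hom, (ModuleCat.mono_iff_injective _).1 inferInstance⟩

/-- If every `h`-divisible module is semi-regular coflat then finitely generated semi-regular ideals
are projective: lifting problems against quotients of injective modules suffice. -/
lemma projective_of_hDivisible_coflat
    (h : ∀ (M : Type u) [AddCommGroup M] [Module R M], IsHDivisible R M → IsSemiRegularCoflat R M)
    (I : Ideal R) (hI : I.FG) (hs : IsSemiRegular I) : Module.Projective R I := by
  refine Module.Projective.of_lifting_property fun {A B} _ _ _ _ p f hp => ?_
  obtain ⟨E, _, _, hE, i, hi⟩ := exists_injective_embedding (R := R) A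
  let K : Submodule R E := p.ker.map i
  -- `B ≅ A / ker p` maps to `E / i(ker p)`, turning the lifting problem along `p` into one along
  -- `K.mkQ`.
  let j : B →ₗ[R] E ⧸ K :=
    (p.ker.mapQ K i (Submodule.le_comap_map _ _)) ∘ₗ
      (p.quotKerEquivOfSurjective hp).symm.toLinearMap
  have hj (a : A) : j (p a) = K.mkQ (i a) := by
    have : (p.quotKerEquivOfSurjective hp).symm (p a) = p.ker.mkQ a := by
      rw [LinearEquiv.symm_apply_eq]; rfl
    simp only [j, LinearMap.comp_apply, LinearEquiv.coe_coe, this]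
    rfl
  obtain ⟨g, hg⟩ := (isSemiRegularCoflat_iff (E ⧸ K)).1
    (h _ ⟨E, inferInstance, inferInstance, hE, K.mkQ, K.mkQ_surjective⟩) I hI hs (j ∘ₗ f)
  obtain ⟨k, hk⟩ := Module.projective_lifting_property K.mkQ g K.mkQ_surjective
  have hkf (x : I) : K.mkQ (k x) = j (f x) := by
    have h1 := LinearMap.congr_fun hk x
    have h2 := LinearMap.congr_fun hg x
    exact h1.trans h2
  -- On `I` the lift `k` differs from a value of `i` by an element of `K ⊆ i(A)`, so it lands in
  -- `i(A)`.
  have hrange (x : I) : (k ∘ₗ I.subtype) x ∈ i.range := by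
    obtain ⟨a, ha⟩ := hp (f x)
    have h1 : k x - i a ∈ K := by
      rw [← K.ker_mkQ, LinearMap.mem_ker, map_sub, hkf, ← ha, hj, sub_self]
    obtain ⟨b, -, hb⟩ := h1
    exact ⟨b + a, by rw [map_add, hb]; simp⟩
  let e := LinearEquiv.ofInjective i hi
  refine ⟨e.symm.toLinearMap ∘ₗ (k ∘ₗ I.subtype).codRestrict i.range hrange, ?_⟩
  ext x
  set a := (e.symm.toLinearMap ∘ₗ (k ∘ₗ I.subtype).codRestrict i.range hrange) x
  have hia : i a = k x := congrArg Subtype.val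
    (e.apply_symm_apply ((k ∘ₗ I.subtype).codRestrict i.range hrange x))
  obtain ⟨a', ha'⟩ := hp (f x)
  -- Since `K = i(ker p)` and `i` is injective, this forces `a - a' ∈ ker p`.
  have h1 : i a - i a' ∈ K := by
    rw [← K.ker_mkQ, LinearMap.mem_ker, map_sub, hia, hkf, ← ha', hj, sub_self]
  obtain ⟨b, hb, hb'⟩ := h1
  rw [← map_sub] at hb'
  have hb'' : p b = p a - p a' := by rw [hi hb', map_sub]
  rw [LinearMap.mem_ker.1 hb, eq_comm, sub_eq_zero] at hb''
  exact hb''.trans ha'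

end Ext

end StrongPrufer

theorem theorem3p5 (R : Type u) [CommRing R] :
    List.TFAE [
      StrongPrufer.IsStrongPrufer R,
      ∀ (M : Type u) [AddCommGroup M] [Module R M], StrongPrufer.IsSemiRegularFlat R M →
        ∀ N : Submodule R M, StrongPrufer.IsSemiRegularFlat R N,
      ∀ (M : Type u) [AddCommGroup M] [Module R M], Module.Flat R M →
        ∀ N : Submodule R M, StrongPrufer.IsSemiRegularFlat R N,
      ∀ I : Ideal R, StrongPrufer.IsSemiRegularFlat R I,
      ∀ I : Ideal R, I.FG → StrongPrufer.IsSemiRegularFlat R I,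
      ∀ I : Ideal R, I.FG → StrongPrufer.IsSemiRegular I → Module.Flat R I,
      ∀ I : Ideal R, I.FG → StrongPrufer.IsSemiRegular I → Module.Projective R I,
      ∀ (M : Type u) [AddCommGroup M] [Module R M], StrongPrufer.IsSemiRegularCoflat R M →
        ∀ N : Submodule R M, StrongPrufer.IsSemiRegularCoflat R (M ⧸ N),
      ∀ (M : Type u) [AddCommGroup M] [Module R M], StrongPrufer.IsHDivisible R M →
        StrongPrufer.IsSemiRegularCoflat R M] := by
  tfae_have 1 → 7 := fun h I hI hs => (h I hI hs).projective hI hs.isDense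
  tfae_have 7 → 6 := fun h I hI hs => have := h I hI hs; inferInstance
  tfae_have 6 → 1 := fun h I hI hs =>
    have := h I hI hs
    StrongPrufer.isLocallyPrincipal_of_flat hI
  tfae_have 6 → 2 := fun h _ _ _ hM N => hM.submodule h N
  tfae_have 2 → 3 := fun h M _ _ _ N => h M (StrongPrufer.isSemiRegularFlat_of_flat M) N
  tfae_have 3 → 4 := fun h I => h R inferInstance I
  tfae_have 4 → 5 := fun h I _ => h I
  tfae_have 5 → 6 := StrongPrufer.flat_of_forall_isSemiRegularFlat
  tfae_have 7 → 8 := fun h _ _ _ hM N => hM.of_surjective h N.mkQ N.mkQ_surjective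
  tfae_have 8 → 9 := by
    rintro h M _ _ ⟨E, _, _, _, f, hf⟩
    exact (h E (StrongPrufer.isSemiRegularCoflat_of_injective E) f.ker).of_linearEquiv
      (f.quotKerEquivOfSurjective hf)
  tfae_have 9 → 7 := StrongPrufer.projective_of_hDivisible_coflat
  tfae_finish
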